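/- There is a universal constant $C>0$ such that for every integer $d\ge 2$ there is an entangled state $\rho_d$ on $\mathbb{C}^d\otimes\mathbb{C}^d\otimes\mathbb{C}^d$ for which $$\rho_d'=p\,\rho_d+(1-p)\,\frac{\mathbb{1}}{d^3}$$ is still an entangled state for every real $p$ with $\frac{C}{d^2}\le p\le 1$. Here a state is a positive semidefinite operator of trace one; it is separable if it is a convex combination of product states $\sigma_1\otimes\sigma_2\otimes\sigma_3$, where each $\sigma_i$ is a state on $\mathbb{C}^d$, and entangled if it is not separable. -/

import Mathlib

open scoped ComplexOrder Kronecker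

/-- `ρ` is a quantum state (density matrix): positive semidefinite (in particular Hermitian) with
trace one. -/
def IsState {ι : Type*} [Fintype ι] (ρ : Matrix ι ι ℂ) : Prop :=
  ρ.PosSemidef ∧ ρ.trace = 1

/-- Matrices acting on `ℂ^d ⊗ ℂ^d ⊗ ℂ^d`, written in the product basis `e_i ⊗ e_j ⊗ e_k`, which is
indexed by the triples `(i, j, k)`. -/
abbrev TripartiteMatrix (d : ℕ) : Type :=
  Matrix (Fin d × Fin d × Fin d) (Fin d × Fin d × Fin d) ℂ

/-- `ρ` is a product state `σ₁ ⊗ σ₂ ⊗ σ₃`, with a state on each of the three factors. -/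
def IsProductState {d : ℕ} (ρ : TripartiteMatrix d) : Prop :=
  ∃ σ₁ σ₂ σ₃ : Matrix (Fin d) (Fin d) ℂ,
    IsState σ₁ ∧ IsState σ₂ ∧ IsState σ₃ ∧ ρ = σ₁ ⊗ₖ (σ₂ ⊗ₖ σ₃)

/-- `ρ` is separable: a (finite) convex combination of product states. -/
def IsSeparableState {d : ℕ} (ρ : TripartiteMatrix d) : Prop :=
  ρ ∈ convexHull ℝ {τ : TripartiteMatrix d | IsProductState τ}

/-- `ρ` is an entangled state: a state that is not separable. -/
def IsEntangled {d : ℕ} (ρ : TripartiteMatrix d) : Prop :=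
  IsState ρ ∧ ¬ IsSeparableState ρ

/-- The mixture `p ρ + (1 - p) 𝟙 / d³` of `ρ` with the maximally mixed state. -/
noncomputable def whiteNoise {d : ℕ} (p : ℝ) (ρ : TripartiteMatrix d) : TripartiteMatrix d :=
  p • ρ + ((1 - p) / (d : ℝ) ^ 3) • (1 : TripartiteMatrix d)

/-! Take `ρ_d` to be a GHZ state on two basis labels and separate it by the linear witness
`ghzWitness`. On separable states the coherence between `000` and `111` is at most the mean of the
`100` and `011` populations, so the witness is nonnegative. GHZ has coherence `1/2` and neither
population; noise adds only `(1 - p) / d ^ 3` to each population, so the witness stays negative for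
`p > 2 / (d ^ 3 + 2)`. -/

/-- The entries of a positive semidefinite matrix satisfy `‖A i j‖² ≤ A i i * A j j`. -/
theorem Matrix.PosSemidef.norm_sq_apply_le {ι : Type*} [Fintype ι] {A : Matrix ι ι ℂ}
    (hA : A.PosSemidef) (i j : ι) : ‖A i j‖ ^ 2 ≤ (A i i).re * (A j j).re := by
  have hdet := (hA.submatrix ![i, j]).det_nonneg
  have hi := (Complex.nonneg_iff.mp (hA.diag_nonneg (i := i))).2
  have hji : A j i = star (A i j) := (hA.isHermitian.apply j i).symm
  rw [Matrix.det_fin_two] at hdet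
  simp only [Matrix.submatrix_apply, Matrix.cons_val_zero, Matrix.cons_val_one, hji,
    Complex.star_def, Complex.mul_conj] at hdet
  have hre := (Complex.nonneg_iff.mp hdet).1
  rw [Complex.sub_re, Complex.mul_re, Complex.ofReal_re, ← hi, Complex.normSq_eq_norm_sq] at hre
  linarith

/-- The real-linear functional `ρ ↦ (ρ₁₀₀ + ρ₀₁₁) / 2 - Re ρ₀₀₀,₁₁₁` on tripartite matrices, where
`i` and `j` play the role of the basis labels `0` and `1`. -/
noncomputable def ghzWitness {d : ℕ} (i j : Fin d) : TripartiteMatrix d →ₗ[ℝ] ℝ where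
  toFun ρ := ((ρ (j, i, i) (j, i, i)).re + (ρ (i, j, j) (i, j, j)).re) / 2
    - (ρ (i, i, i) (j, j, j)).re
  map_add' ρ τ := by simp only [Matrix.add_apply, Complex.add_re]; ring
  map_smul' c ρ := by
    simp only [Matrix.smul_apply, Complex.smul_re, smul_eq_mul, RingHom.id_apply]; ring

theorem ghzWitness_apply {d : ℕ} (i j : Fin d) (ρ : TripartiteMatrix d) :
    ghzWitness i j ρ = ((ρ (j, i, i) (j, i, i)).re + (ρ (i, j, j) (i, j, j)).re) / 2
      - (ρ (i, i, i) (j, j, j)).re := rfl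

theorem IsProductState.ghzWitness_nonneg {d : ℕ} {ρ : TripartiteMatrix d} (hρ : IsProductState ρ)
    (i j : Fin d) : 0 ≤ ghzWitness i j ρ := by
  obtain ⟨σ₁, σ₂, σ₃, ⟨h₁, -⟩, ⟨h₂, -⟩, ⟨h₃, -⟩, rfl⟩ := hρ
  have re_diag : ∀ {σ : Matrix (Fin d) (Fin d) ℂ}, σ.PosSemidef → ∀ k,
      0 ≤ (σ k k).re ∧ 0 = (σ k k).im := fun h k => Complex.nonneg_iff.mp h.diag_nonneg
  rw [ghzWitness_apply]
  simp only [Matrix.kroneckerMap_apply]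
  have re_mul : ∀ k l m, (σ₁ k k * (σ₂ l l * σ₃ m m)).re
      = (σ₁ k k).re * ((σ₂ l l).re * (σ₃ m m).re) := fun k l m => by
    simp only [Complex.mul_re, Complex.mul_im, ← (re_diag h₁ k).2, ← (re_diag h₂ l).2,
      ← (re_diag h₃ m).2]
    ring
  rw [re_mul, re_mul]
  set x := (σ₁ j j).re * ((σ₂ i i).re * (σ₃ i i).re)
  set y := (σ₁ i i).re * ((σ₂ j j).re * (σ₃ j j).re)
  have hx : 0 ≤ x := mul_nonneg (re_diag h₁ j).1 (mul_nonneg (re_diag h₂ i).1 (re_diag h₃ i).1)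
  have hy : 0 ≤ y := mul_nonneg (re_diag h₁ i).1 (mul_nonneg (re_diag h₂ j).1 (re_diag h₃ j).1)
  -- The three 2×2 minor bounds involve six diagonal entries, which regroup as `x * y`; AM-GM then
  -- gives `(x + y) / 2`.
  have hz : ‖σ₁ i j * (σ₂ i j * σ₃ i j)‖ ^ 2 ≤ x * y := by
    calc ‖σ₁ i j * (σ₂ i j * σ₃ i j)‖ ^ 2
        = ‖σ₁ i j‖ ^ 2 * (‖σ₂ i j‖ ^ 2 * ‖σ₃ i j‖ ^ 2) := by
          rw [norm_mul, norm_mul, mul_pow, mul_pow]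
      _ ≤ ((σ₁ i i).re * (σ₁ j j).re) * (((σ₂ i i).re * (σ₂ j j).re)
            * ((σ₃ i i).re * (σ₃ j j).re)) := by
          have hn : 0 ≤ (σ₂ i i).re * (σ₂ j j).re := mul_nonneg (re_diag h₂ i).1 (re_diag h₂ j).1
          have hm : 0 ≤ (σ₁ i i).re * (σ₁ j j).re := mul_nonneg (re_diag h₁ i).1 (re_diag h₁ j).1
          gcongr
          · exact h₁.norm_sq_apply_le i j
          · exact h₂.norm_sq_apply_le i j
          · exact h₃.norm_sq_apply_le i j
      _ = x * y := by ring
  have hle : ‖σ₁ i j * (σ₂ i j * σ₃ i j)‖ ≤ (x + y) / 2 :=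
    abs_le_of_sq_le_sq' (by nlinarith [sq_nonneg (x - y)]) (by linarith) |>.2
  linarith [Complex.re_le_norm (σ₁ i j * (σ₂ i j * σ₃ i j))]

theorem IsSeparableState.ghzWitness_nonneg {d : ℕ} {ρ : TripartiteMatrix d}
    (hρ : IsSeparableState ρ) (i j : Fin d) : 0 ≤ ghzWitness i j ρ :=
  convexHull_min (fun _ hτ => IsProductState.ghzWitness_nonneg hτ i j)
    (convex_halfSpace_ge (ghzWitness i j).isLinear 0) hρ

/-- White noise keeps states states. -/
theorem IsState.whiteNoise {d : ℕ} (hd : d ≠ 0) {ρ : TripartiteMatrix d} (hρ : IsState ρ) {p : ℝ}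
    (h0 : 0 ≤ p) (h1 : p ≤ 1) : IsState (whiteNoise p ρ) := by
  have hd' : (d : ℂ) ≠ 0 := Nat.cast_ne_zero.mpr hd
  refine ⟨(hρ.1.smul h0).add (Matrix.PosSemidef.one.smul
    (div_nonneg (sub_nonneg.mpr h1) (by positivity))), ?_⟩
  rw [_root_.whiteNoise, Matrix.trace_add, Matrix.trace_smul, Matrix.trace_smul, hρ.2,
    Matrix.trace_one]
  simp only [Fintype.card_prod, Fintype.card_fin, Complex.real_smul]
  push_cast
  field_simp
  ring

/-- The vector `e_i ⊗ e_i ⊗ e_i + e_j ⊗ e_j ⊗ e_j`. -/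
def ghzVector {d : ℕ} (i j : Fin d) : Fin d × Fin d × Fin d → ℂ :=
  Pi.single (i, i, i) 1 + Pi.single (j, j, j) 1

/-- The Greenberger–Horne–Zeilinger state on the basis vectors labelled `i` and `j`. -/
noncomputable def ghzState {d : ℕ} (i j : Fin d) : TripartiteMatrix d :=
  (1 / 2 : ℝ) • Matrix.vecMulVec (ghzVector i j) (star (ghzVector i j))

theorem isState_ghzState {d : ℕ} {i j : Fin d} (hij : i ≠ j) : IsState (ghzState i j) := by
  refine ⟨(Matrix.posSemidef_vecMulVec_self_star _).smul (by norm_num), ?_⟩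
  rw [ghzState, Matrix.trace_smul, Matrix.trace_vecMulVec, ghzVector, star_add, Pi.star_single,
    Pi.star_single, add_dotProduct, single_dotProduct, single_dotProduct]
  simp [hij, hij.symm]
  norm_num

theorem ghzWitness_whiteNoise_ghzState {d : ℕ} {i j : Fin d} (hij : i ≠ j) (p : ℝ) :
    ghzWitness i j (whiteNoise p (ghzState i j)) = (1 - p) / (d : ℝ) ^ 3 - p / 2 := by
  rw [whiteNoise, map_add, map_smul, map_smul, ghzWitness_apply, ghzWitness_apply]
  simp [ghzState, ghzVector, Matrix.vecMulVec_apply, hij, hij.symm]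
  ring

theorem isEntangled_whiteNoise_ghzState {d : ℕ} (hd : d ≠ 0) {i j : Fin d} (hij : i ≠ j) {p : ℝ}
    (h0 : 0 ≤ p) (h1 : p ≤ 1) (hp : (1 - p) / (d : ℝ) ^ 3 < p / 2) :
    IsEntangled (whiteNoise p (ghzState i j)) := by
  refine ⟨(isState_ghzState hij).whiteNoise hd h0 h1, fun hs => ?_⟩
  have h := hs.ghzWitness_nonneg i j
  rw [ghzWitness_whiteNoise_ghzState hij] at h
  linarith

theorem theorem2 :
    ∃ C : ℝ, 0 < C ∧ ∀ d : ℕ, 2 ≤ d →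
      ∃ ρ : TripartiteMatrix d, IsEntangled ρ ∧
        ∀ p : ℝ, C / (d : ℝ) ^ 2 ≤ p → p ≤ 1 → IsEntangled (whiteNoise p ρ) := by
  -- `C = 1` is ample: the witness's threshold has order `d ^ (-3)`.
  refine ⟨1, one_pos, fun d hd => ?_⟩
  have hij : (⟨0, by omega⟩ : Fin d) ≠ ⟨1, by omega⟩ := by simp
  have hd0 : d ≠ 0 := by omega
  have hd2 : (2 : ℝ) ≤ d := by exact_mod_cast hd
  refine ⟨ghzState ⟨0, by omega⟩ ⟨1, by omega⟩, ?_, fun p hp h1 => ?_⟩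
  · have h := isEntangled_whiteNoise_ghzState hd0 hij (p := 1) zero_le_one le_rfl (by norm_num)
    simpa [whiteNoise] using h
  · have hpos : 0 < p := lt_of_lt_of_le (by positivity) hp
    refine isEntangled_whiteNoise_ghzState hd0 hij hpos.le h1 ?_
    rw [div_le_iff₀ (by positivity)] at hp
    rw [div_lt_iff₀ (by positivity)]
    -- Hence `p * d ^ 3 / 2 ≥ d / 2 ≥ 1 > 1 - p`.
    have : (d : ℝ) * 1 ≤ d * (p * (d : ℝ) ^ 2) := by gcongr
    nlinarith
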